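/- All graphs are finite. For a graph $G$ and $S\subseteq V(G)$, let $G-S$ be the graph obtained by deleting the vertices in $S$, let $iso(G)$ be the number of isolated vertices of $G$, let $d_G(v)$ be the degree of $v$ in $G$, and let $Leaf(G)$ be the set of vertices of degree $1$ of $G$. For an edge $e$, $G-e$ is the graph obtained by deleting $e$. A star is a graph isomorphic to $K_{1,i}$ for some $i\ge 1$. For integers $0<m<n$ let $\mathcal{T}_{n/m}$ be the set of trees $T$ (up to isomorphism) such that - $iso(T-S)\le \frac nm|S|$ for all $S\subseteq V(T)$, and - for every $e\in E(T)$ there is a set $S^*\subseteq V(T)$ with $iso((T-e)-S^*)>\frac nm|S^*|$. Let $n,m$ be integers with $0<m<n$ and let $T\in\mathcal{T}_{n/m}$ be a tree with bipartition $\{A,B\}$, where $0<|B|\le|A|$. Then: 1. either $T\cong K_{1,1}$ or $Leaf(T)\subseteq A$ (exactly one of the two holds); 2. $d_T(a)\le m$ for every $a\in A$; 3. $d_T(b)\le n$ for every $b\in B$; 4. $d_T(x)=\lfloor \frac nm\rfloor+1$ for every $x\in Leaf(T-Leaf(T))$; 5. if $n\equiv 1 \pmod m$, then $T$ is a star, or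 $|A|=\frac nm|B|$ and $|V(T)|$ is a multiple of $n+m$ (both may hold). As a consequence, for every integer $n>1$, $\mathcal{T}_{n/1}=\{K_{1,i} : 1\le i\le n\}$. -/

import Mathlib

namespace IsoFactor

/-- The degree of `v` in `G`: the number of neighbours of `v`. -/
noncomputable def deg {V : Type*} (G : SimpleGraph V) (v : V) : ℕ :=
  (G.neighborSet v).ncard

theorem deg_eq_degree {V : Type*} (G : SimpleGraph V) (v : V) [Fintype (G.neighborSet v)] :
    deg G v = G.degree v := by
  unfold deg
  rw [← SimpleGraph.card_neighborSet_eq_degree, Set.ncard_eq_toFinset_card', Set.toFinset_card]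

/-- The graph `G - S` obtained from `G` by deleting the vertices in `S`. -/
abbrev delVerts {V : Type*} (G : SimpleGraph V) (S : Set V) : SimpleGraph ↥(Sᶜ) :=
  G.induce Sᶜ

/-- The number `iso(G)` of isolated vertices of `G`. -/
noncomputable def iso {V : Type*} (G : SimpleGraph V) : ℕ :=
  {v : V | G.IsIsolated v}.ncard

/-- The set of vertices of degree `1`. -/
def leaf {V : Type*} (G : SimpleGraph V) : Set V :=
  {v : V | deg G v = 1}

/-- The star `K_{1,i}`. -/
abbrev starK (i : ℕ) : SimpleGraph (Fin 1 ⊕ Fin i) :=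
  completeBipartiteGraph (Fin 1) (Fin i)

/-- `G` is a star, i.e. isomorphic to `K_{1,i}` for some `i ≥ 1`. -/
def IsStar {V : Type*} (G : SimpleGraph V) : Prop :=
  ∃ i : ℕ, 1 ≤ i ∧ Nonempty (G ≃g starK i)

/-- `{A, B}` is a bipartition of `G`. -/
def IsBipartition {V : Type*} (G : SimpleGraph V) (A B : Set V) : Prop :=
  G.IsBipartiteWith A B ∧ A ∪ B = Set.univ

/-- Membership in the family `𝒯_{n/m}` (for graphs on a finite vertex type). -/
structure MemT {V : Type*} (n m : ℕ) (T : SimpleGraph V) : Prop where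
  isTree : T.IsTree
  iso_le : ∀ S : Set V, (iso (delVerts T S) : ℚ) ≤ (n : ℚ) / (m : ℚ) * (S.ncard : ℚ)
  minimal : ∀ e ∈ T.edgeSet, ∃ S : Set V,
    (n : ℚ) / (m : ℚ) * (S.ncard : ℚ) < (iso (delVerts (T.deleteEdges {e}) S) : ℚ)

end IsoFactor

namespace IsoFactor

open Finset

/-! For `0 < m ≤ n`, the bound on `iso` holds exactly when there are nonnegative edge weights whose
vertex totals all lie in `[m, n]` (`IsWeighting.iso_le`, `exists_nonneg_weighting`). Minimality of
`T` strengthens this: every real weighting of `T` with totals in `[m, n]`, negative entries being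
allowed a priori, is positive on every edge (`MemT.weighting_pos`).

Since `T` is connected and bipartite, any integer totals that balance between `A` and `B` come from
integer weights (`exists_int_weighting`). So there are positive integer weights with total `m` at
each vertex of `A`, totals in `[m, n]` on `B`, and a chosen total `c` at one vertex of `B`
(`MemT.exists_posWeighting`).

The structure of `T` is read off from these. A degree is at most the total, which bounds the
degrees. A leaf in `B` uses up the whole `m` of its neighbor, which forces `K_{1,1}`. At a leaf `x`
of `T - Leaf(T)`, of degree `d` in `T`, all edges but one have weight `m` and the last has less, so
the total lies strictly between `m(d-1)` and `md`; good choices of `c` give `d`, and `m|A| = n|B|`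
when `n ≡ 1 [MOD m]` and `T` is not a star. -/

/-! ### Edge weightings and the isolated-vertex condition -/

/-- `w` is a symmetric edge weighting of `G` whose total at each vertex `v` is `y v`. -/
structure IsWeighting {V : Type*} [Fintype V] (G : SimpleGraph V) (w : V → V → ℝ) (y : V → ℝ) :
    Prop where
  symm : ∀ u v, w u v = w v u
  supp : ∀ u v, ¬ G.Adj u v → w u v = 0
  sum : ∀ v, ∑ u, w v u = y v

theorem iso_delVerts {V : Type*} (G : SimpleGraph V) (S : Set V) :
    iso (delVerts G S) = {v : V | v ∉ S ∧ ∀ u, u ∉ S → ¬ G.Adj v u}.ncard := by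
  unfold iso
  rw [← Set.ncard_image_of_injective _ Subtype.val_injective]
  congr 1
  ext v
  simp only [SimpleGraph.IsIsolated, Set.mem_image, Set.mem_ofPred_eq, Subtype.exists,
    Subtype.forall, SimpleGraph.comap_adj, Function.Embedding.subtype_apply, Set.mem_compl_iff]
  constructor
  · rintro ⟨a, ha, h, rfl⟩
    exact ⟨ha, h⟩
  · rintro ⟨ha, h⟩
    exact ⟨v, ha, h, rfl⟩

/-- Double counting: the isolated vertices of `G - S` send all their weight, at least `m` each, into
`S`, where each vertex takes at most `n`. -/
theorem IsWeighting.iso_le {V : Type*} [Fintype V] {G : SimpleGraph V} {w : V → V → ℝ} {y : V → ℝ}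
    (h : IsWeighting G w y) (hw : ∀ u v, 0 ≤ w u v) {n m : ℕ} (hm : 0 < m)
    (hy : ∀ v, (m : ℝ) ≤ y v) (hy' : ∀ v, y v ≤ n) (S : Set V) :
    (iso (delVerts G S) : ℚ) ≤ (n : ℚ) / (m : ℚ) * (S.ncard : ℚ) := by
  classical
  have key : (m : ℝ) * (iso (delVerts G S) : ℝ) ≤ n * (S.ncard : ℝ) := by
    rw [iso_delVerts, Set.ncard_eq_toFinset_card', Set.ncard_eq_toFinset_card']
    set I := {v : V | v ∉ S ∧ ∀ u, u ∉ S → ¬ G.Adj v u}.toFinset with hI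
    calc (m : ℝ) * (#I : ℝ) = ∑ _i ∈ I, (m : ℝ) := by simp [mul_comm]
      _ ≤ ∑ i ∈ I, ∑ s, w i s := sum_le_sum fun i _ => by rw [h.sum]; exact hy i
      _ = ∑ i ∈ I, ∑ s ∈ S.toFinset, w i s := by
          refine sum_congr rfl fun i hi => ?_
          refine (sum_subset (subset_univ _) fun s _ hs => h.supp _ _ ?_).symm
          rw [hI, Set.mem_toFinset] at hi
          exact hi.2 s (by simpa using hs)
      _ = ∑ s ∈ S.toFinset, ∑ i ∈ I, w s i := by
          rw [sum_comm]
          exact sum_congr rfl fun s _ => sum_congr rfl fun i _ => h.symm _ _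
      _ ≤ ∑ s ∈ S.toFinset, ∑ i, w s i :=
          sum_le_sum fun s _ => sum_le_sum_of_subset_of_nonneg (subset_univ _) fun i _ _ => hw _ _
      _ ≤ ∑ _s ∈ S.toFinset, (n : ℝ) := sum_le_sum fun s _ => by rw [h.sum]; exact hy' s
      _ = n * (#S.toFinset : ℝ) := by simp [mul_comm]
  rw [div_mul_eq_mul_div, le_div_iff₀ (by exact_mod_cast hm), mul_comm]
  exact_mod_cast key

/-- Deleting `N(X) \ X` isolates the vertices of `X` outside `N(X)`; those in `X ∩ N(X)` count on
both sides and only need `m ≤ n`. This is Hall's condition for `m` copies of each vertex against `n`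
copies. -/
theorem card_le_of_iso_le {V : Type*} [Fintype V] [DecidableEq V] {G : SimpleGraph V}
    [DecidableRel G.Adj] {n m : ℕ} (hm : 0 < m) (hmn : m ≤ n)
    (h : ∀ S : Set V, (iso (delVerts G S) : ℚ) ≤ (n : ℚ) / (m : ℚ) * (S.ncard : ℚ))
    (X : Finset V) : m * #X ≤ n * #(X.biUnion fun v => univ.filter (G.Adj v)) := by
  set N := X.biUnion fun v => univ.filter (G.Adj v) with hN
  have memN : ∀ u, u ∈ N ↔ ∃ v ∈ X, G.Adj v u := by simp [hN]
  set I := X.filter fun v => v ∉ N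
  have h1 : m * #I ≤ n * #(N \ X) := by
    have hS := h (N \ X : Finset V)
    rw [iso_delVerts, Set.ncard_coe_finset, div_mul_eq_mul_div,
      le_div_iff₀ (by exact_mod_cast hm), mul_comm] at hS
    refine le_trans (Nat.mul_le_mul_left _ ?_) (by exact_mod_cast hS)
    rw [← Set.ncard_coe_finset]
    refine Set.ncard_le_ncard (fun v hv => ?_) (Set.toFinite _)
    have hv' := mem_filter.1 (mem_coe.1 hv)
    refine ⟨by simp [hv'.1], fun u hu huv => ?_⟩
    have huN : u ∈ N := (memN u).2 ⟨v, hv'.1, huv⟩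
    have huX : u ∈ X := by
      by_contra hx
      exact hu (by simp [huN, hx])
    exact hv'.2 ((memN v).2 ⟨u, huX, huv.symm⟩)
  have h2 : #X = #I + #(X ∩ N) := by
    rw [← card_filter_add_card_filter_not (s := X) (fun v => v ∉ N)]
    simp [I, filter_mem_eq_inter]
  have h3 : #N = #(N \ X) + #(X ∩ N) := by
    rw [inter_comm]; exact (card_sdiff_add_card_inter N X).symm
  rw [h2, h3, mul_add, mul_add]
  exact Nat.add_le_add h1 (Nat.mul_le_mul_right _ hmn)

theorem exists_injective_adj {V : Type*} [Fintype V] {G : SimpleGraph V} {n m : ℕ} (hm : 0 < m)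
    (hmn : m ≤ n)
    (h : ∀ S : Set V, (iso (delVerts G S) : ℚ) ≤ (n : ℚ) / (m : ℚ) * (S.ncard : ℚ)) :
    ∃ f : V × Fin m → V × Fin n, Function.Injective f ∧ ∀ p, G.Adj p.1 (f p).1 := by
  classical
  have := (Finset.all_card_le_biUnion_card_iff_exists_injective
    (fun p : V × Fin m => (univ.filter (G.Adj p.1)) ×ˢ (univ : Finset (Fin n)))).1 (fun s => by
      have h1 := card_le_of_iso_le hm hmn h (s.image Prod.fst)
      have h2 : #s ≤ m * #(s.image Prod.fst) := by
        calc #s ≤ #((s.image Prod.fst) ×ˢ (univ : Finset (Fin m))) :=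
              card_le_card fun p hp => by
                simp only [mem_product, mem_univ, and_true]
                exact mem_image_of_mem _ hp
          _ = _ := by simp [mul_comm]
      refine h2.trans (h1.trans (le_of_eq ?_))
      have : (s.biUnion fun p => (univ.filter (G.Adj p.1)) ×ˢ (univ : Finset (Fin n))) =
          ((s.image Prod.fst).biUnion fun v => univ.filter (G.Adj v)) ×ˢ univ := by
        ext ⟨a, b⟩
        simp
      rw [this, card_product, card_univ, Fintype.card_fin, mul_comm])
  obtain ⟨f, hf, hf'⟩ := this
  exact ⟨f, hf, fun p => by simpa using hf' p⟩

/-- If no such weighting existed, Hahn–Banach would separate the compact convex set of achievable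
total vectors from the box `[m, n]^V`; the Hall injection `f` yields a weighting that defeats the
separating functional. -/
theorem exists_nonneg_weighting {V : Type*} [Fintype V] {G : SimpleGraph V} {n m : ℕ} (hm : 0 < m)
    (hmn : m ≤ n)
    (h : ∀ S : Set V, (iso (delVerts G S) : ℚ) ≤ (n : ℚ) / (m : ℚ) * (S.ncard : ℚ)) :
    ∃ (w : V → V → ℝ) (y : V → ℝ), IsWeighting G w y ∧ (∀ u v, 0 ≤ w u v) ∧
      (∀ v, (m : ℝ) ≤ y v) ∧ ∀ v, y v ≤ n := by
  classical
  obtain ⟨f, hf, hadj⟩ := exists_injective_adj hm hmn h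
  let K : Set (V → V → ℝ) := Set.Icc 0 (fun u v => if G.Adj u v then (m : ℝ) else 0)
  let D : (V → V → ℝ) →ₗ[ℝ] (V → ℝ) :=
    { toFun := fun w v => ∑ u, (w v u + w u v)
      map_add' := fun w w' => by
        ext v; simp only [Pi.add_apply, ← sum_add_distrib]
        exact sum_congr rfl fun u _ => by ring
      map_smul' := fun c w => by
        ext v; simp [mul_sum, mul_add] }
  have hD : Continuous D := D.continuous_of_finiteDimensional
  have hK : IsCompact K := isCompact_Icc
  have hKc : Convex ℝ K := convex_Icc _ _
  by_contra hne
  have disj : Disjoint (D '' K) (Set.Icc (fun _ => (m : ℝ)) (fun _ => (n : ℝ)) : Set (V → ℝ)) := by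
    rw [Set.disjoint_left]
    rintro y ⟨w, hw, rfl⟩ ⟨hy, hy'⟩
    refine hne ⟨fun u v => w u v + w v u, D w, ⟨fun u v => add_comm _ _, fun u v huv => ?_,
      fun v => rfl⟩, fun u v => add_nonneg (hw.1 u v) (hw.1 v u), fun v => hy v, fun v => hy' v⟩
    have h1 := hw.1 u v
    have h2 := hw.2 u v
    have h3 := hw.1 v u
    have h4 := hw.2 v u
    dsimp only at h2 h4
    rw [if_neg huv] at h2
    rw [if_neg (fun h' => huv h'.symm)] at h4
    simp only [Pi.zero_apply] at h1 h3
    linarith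
  obtain ⟨φ, s, t, hs, hst, ht⟩ := geometric_hahn_banach_compact_closed
    (hKc.linear_image D) (hK.image hD) (convex_Icc _ _) isClosed_Icc disj
  let c : V → ℝ := fun v => φ (Pi.single v 1)
  have hφ : ∀ z : V → ℝ, φ z = ∑ v, z v * c v := fun z => by
    conv_lhs => rw [pi_eq_sum_univ' z, map_sum]
    refine sum_congr rfl fun v _ => ?_
    rw [map_smul, smul_eq_mul]
  -- The point of the box where the functional is smallest.
  let y : V → ℝ := fun v => if 0 < c v then m else n
  have hmn' : (m : ℝ) ≤ n := by exact_mod_cast hmn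
  have hy := ht y ⟨fun v => by dsimp [y]; split_ifs <;> simp [hmn'],
    fun v => by dsimp [y]; split_ifs <;> simp [hmn']⟩
  -- Each vertex with positive coefficient sends `m` units along `f`. As `f` is injective, each
  -- vertex receives at most `n`, so the negative coefficients cost no more than they do in `y`.
  let w : V → V → ℝ := fun v u =>
    ∑ i : Fin m, if (f (v, i)).1 = u ∧ 0 < c v then (1 : ℝ) else 0
  have hw : w ∈ K := by
    refine ⟨fun v u => sum_nonneg fun i _ => by split_ifs <;> simp, fun v u => ?_⟩
    dsimp only [w]
    split_ifs with huv
    · calc _ ≤ ∑ _i : Fin m, (1 : ℝ) := sum_le_sum fun i _ => by split_ifs <;> simp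
        _ = m := by simp
    · refine le_of_eq (sum_eq_zero fun i _ => if_neg ?_)
      rintro ⟨rfl, -⟩
      exact huv (hadj (v, i))
  have hs' := hs (D w) ⟨w, hw, rfl⟩
  rw [hφ] at hy hs'
  have e1 : ∑ v, D w v * c v = ∑ p : V × Fin m,
      if 0 < c p.1 then c p.1 + c (f p).1 else 0 := by
    have : ∀ v, D w v * c v = ∑ u, w v u * c v + ∑ u, w u v * c v := fun v => by
      simp only [D, LinearMap.coe_mk, AddHom.coe_mk, sum_add_distrib, add_mul, sum_mul]
    rw [sum_congr rfl fun v _ => this v, sum_add_distrib,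
      sum_comm (f := fun v u => w u v * c v), ← sum_add_distrib, Fintype.sum_prod_type]
    refine sum_congr rfl fun v _ => ?_
    rw [← sum_add_distrib]
    simp only [w, sum_mul, ← sum_add_distrib]
    rw [sum_comm]
    refine sum_congr rfl fun i _ => ?_
    by_cases hc : 0 < c v <;> simp [hc, sum_add_distrib]
  have e2 : ∑ v, y v * c v ≤ ∑ p : V × Fin m, (if 0 < c p.1 then c p.1 else 0) +
      ∑ q : V × Fin n, min (c q.1) 0 := by
    rw [Fintype.sum_prod_type, Fintype.sum_prod_type, ← sum_add_distrib]
    refine sum_le_sum fun v _ => ?_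
    by_cases hc : 0 < c v
    · simp [y, hc, hc.le]
    · simp [y, hc, min_eq_left (not_lt.1 hc)]
  have e3 : ∑ q : V × Fin n, min (c q.1) 0 ≤ ∑ p : V × Fin m, min (c (f p).1) 0 := by
    rw [← sum_image (f := fun q : V × Fin n => min (c q.1) 0) (g := f) (s := univ)
      (fun a _ b _ hab => hf hab)]
    have := sum_le_sum_of_subset_of_nonneg (f := fun q : V × Fin n => -min (c q.1) 0)
      (subset_univ (univ.image f)) fun q _ _ => by simp
    simp only [sum_neg_distrib] at this
    linarith
  have e4 : ∑ p : V × Fin m, (if 0 < c p.1 then c p.1 else 0) +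
      ∑ p : V × Fin m, min (c (f p).1) 0 ≤
      ∑ p : V × Fin m, if 0 < c p.1 then c p.1 + c (f p).1 else 0 := by
    rw [← sum_add_distrib]
    refine sum_le_sum fun p _ => ?_
    split_ifs
    · gcongr; exact min_le_left _ _
    · simp
  linarith

/-! ### Integer weightings with prescribed totals -/

/-- Weights alternating `+1, -1` along the walk cancel at its interior visits and leave only the end
contributions. -/
theorem exists_int_weighting_of_walk {V : Type*} [Fintype V] [DecidableEq V] {G : SimpleGraph V}
    {s : V → ℤ} (hs : ∀ u v, G.Adj u v → s u = -s v) (hs1 : ∀ v, s v * s v = 1) {u r : V}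
    (p : G.Walk u r) :
    ∃ w : V → V → ℤ, (∀ a b, w a b = w b a) ∧ (∀ a b, ¬ G.Adj a b → w a b = 0) ∧
      ∀ v, ∑ x, w v x = (if v = u then 1 else 0) - s u * s r * (if v = r then 1 else 0) := by
  induction p with
  | nil => exact ⟨0, by simp, by simp, by simp [hs1]⟩
  | @cons u u' r h p ih =>
    obtain ⟨w, h1, h2, h3⟩ := ih
    refine ⟨fun a b => (if a = u ∧ b = u' then 1 else 0) + (if a = u' ∧ b = u then 1 else 0) - w a b,
      fun a b => ?_, fun a b hab => ?_, fun v => ?_⟩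
    · dsimp only
      have := h1 a b
      split_ifs <;> grind
    · dsimp only
      rw [h2 a b hab, if_neg, if_neg]
      · simp
      · rintro ⟨rfl, rfl⟩; exact hab h.symm
      · rintro ⟨rfl, rfl⟩; exact hab h
    · rw [sum_sub_distrib, sum_add_distrib, h3, hs _ _ h]
      have e : ∀ a b : V, (∑ x, if v = a ∧ x = b then (1 : ℤ) else 0) = if v = a then 1 else 0 :=
        fun a b => by by_cases hv : v = a <;> simp [hv]
      rw [e, e]
      ring

/-- Each vertex's demand is carried to a root `r` along a walk; the residue at `r` is a multiple of
the signed sum of `z`, which vanishes. -/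
theorem exists_int_weighting {V : Type*} [Fintype V] {G : SimpleGraph V} (hG : G.Connected)
    {s : V → ℤ} (hs : ∀ u v, G.Adj u v → s u = -s v) (hs1 : ∀ v, s v * s v = 1) (z : V → ℤ)
    (hz : ∑ v, s v * z v = 0) :
    ∃ w : V → V → ℤ, (∀ a b, w a b = w b a) ∧ (∀ a b, ¬ G.Adj a b → w a b = 0) ∧
      ∀ v, ∑ x, w v x = z v := by
  classical
  obtain ⟨r⟩ := hG.nonempty
  choose W h1 h2 h3 using fun u => exists_int_weighting_of_walk hs hs1 (hG.preconnected u r).some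
  refine ⟨fun a b => ∑ u, z u * W u a b, fun a b => ?_, fun a b hab => ?_, fun v => ?_⟩
  · exact sum_congr rfl fun u _ => by rw [h1]
  · exact sum_eq_zero fun u _ => by rw [h2 u a b hab, mul_zero]
  · rw [sum_comm]
    simp only [← mul_sum, h3, mul_sub, sum_sub_distrib]
    have : ∑ u, z u * (s u * s r * if v = r then 1 else 0) =
        (∑ u, s u * z u) * (s r * if v = r then 1 else 0) := by
      rw [sum_mul]
      exact sum_congr rfl fun u _ => by ring
    rw [this, hz]
    simp

/-! ### Positivity from minimality -/

/-- Move from a nonnegative weighting `w₀` towards `w`. If `w` is not positive on every edge, stop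
when the first edge vanishes: the result is a nonnegative weighting of `T - e` with totals still in
`[m, n]`, contradicting minimality at `e`. -/
theorem MemT.weighting_pos {V : Type*} [Fintype V] {T : SimpleGraph V} {n m : ℕ} (hm : 0 < m)
    (hmn : m ≤ n) (hT : MemT n m T) {w : V → V → ℝ} {y : V → ℝ} (hw : IsWeighting T w y)
    (hy : ∀ v, (m : ℝ) ≤ y v) (hy' : ∀ v, y v ≤ n) {a b : V} (hab : T.Adj a b) : 0 < w a b := by
  classical
  by_contra hneg
  obtain ⟨w₀, y₀, hw₀, hn₀, hm₀, hn₀'⟩ := exists_nonneg_weighting hm hmn hT.iso_le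
  let P : Finset (V × V) := univ.filter fun p => T.Adj p.1 p.2 ∧ w p.1 p.2 ≤ 0
  -- The time at which the edge reaches zero; if both weights are zero, `0 / 0 = 0` is the right
  -- value.
  let τ : V × V → ℝ := fun p => w₀ p.1 p.2 / (w₀ p.1 p.2 - w p.1 p.2)
  have hP : P.Nonempty := ⟨(a, b), by simpa [P, hab] using hneg⟩
  obtain ⟨⟨c, d⟩, hcd, hmin⟩ := P.exists_min_image τ hP
  simp only [P, mem_filter, mem_univ, true_and] at hcd hmin
  set t := τ (c, d) with ht
  have ht0 : 0 ≤ t := div_nonneg (hn₀ _ _) (by dsimp only; linarith [hn₀ c d, hcd.2])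
  have ht1 : t ≤ 1 := div_le_one_of_le₀ (by dsimp only; linarith [hcd.2])
    (by dsimp only; linarith [hn₀ c d, hcd.2])
  have hsub : ∀ u v, w u v ≤ 0 → τ (u, v) * (w₀ u v - w u v) = w₀ u v := fun u v huv => by
    by_cases h0 : w₀ u v - w u v = 0
    · have : w₀ u v = 0 := by linarith [hn₀ u v]
      rw [h0, this, mul_zero]
    · exact div_mul_cancel₀ _ h0
  let w' : V → V → ℝ := fun u v => (1 - t) * w₀ u v + t * w u v
  have hzero : w' c d = 0 := by
    have := hsub c d hcd.2
    rw [← ht] at this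
    dsimp only [w']
    linarith
  have hsymm : ∀ u v, w' u v = w' v u := fun u v => by
    dsimp only [w']; rw [hw.symm u v, hw₀.symm u v]
  have hnonneg : ∀ u v, 0 ≤ w' u v := fun u v => by
    dsimp only [w']
    by_cases huv : T.Adj u v
    · rcases lt_or_ge 0 (w u v) with h | h
      · exact add_nonneg (mul_nonneg (by linarith) (hn₀ _ _)) (mul_nonneg ht0 h.le)
      · have h1 := hmin (u, v) ⟨huv, h⟩
        have h2 := hsub u v h
        have h3 := mul_le_mul_of_nonneg_right h1
          (show 0 ≤ w₀ u v - w u v by linarith [hn₀ u v])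
        linarith
    · rw [hw.supp _ _ huv, hw₀.supp _ _ huv]; simp
  have hweight : IsWeighting (T.deleteEdges {s(c, d)}) w' (fun v => (1 - t) * y₀ v + t * y v) := by
    refine ⟨hsymm, fun u v huv => ?_, fun v => ?_⟩
    · rw [SimpleGraph.deleteEdges_adj, not_and_not_right] at huv
      by_cases h : T.Adj u v
      · have := huv h
        rw [Set.mem_singleton_iff, Sym2.eq_iff] at this
        rcases this with ⟨rfl, rfl⟩ | ⟨rfl, rfl⟩
        · exact hzero
        · rw [hsymm, hzero]
      · dsimp only [w']
        rw [hw.supp _ _ h, hw₀.supp _ _ h]; simp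
    · simp only [w', sum_add_distrib, ← mul_sum, hw.sum, hw₀.sum]
  obtain ⟨S, hS⟩ := hT.minimal s(c, d) hcd.1
  refine absurd (hweight.iso_le hnonneg hm (n := n) (fun v => ?_) (fun v => ?_) S) (not_le.2 hS)
  · nlinarith [hm₀ v, hy v]
  · nlinarith [hn₀' v, hy' v]

theorem exists_sum_eq {V : Type*} [DecidableEq V] {m n : ℤ} (hmn : m ≤ n) (B : Finset V) (s : ℤ)
    (h1 : m * #B ≤ s) (h2 : s ≤ n * #B) :
    ∃ z : V → ℤ, (∀ v, m ≤ z v ∧ z v ≤ n) ∧ ∑ v ∈ B, z v = s := by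
  induction B using Finset.induction_on generalizing s with
  | empty => exact ⟨fun _ => m, fun _ => ⟨le_rfl, hmn⟩, by simp at *; omega⟩
  | insert b B hb ih =>
    rw [card_insert_of_notMem hb] at h1 h2
    push_cast at h1 h2
    have h3 : m * #B ≤ n * #B := mul_le_mul_of_nonneg_right hmn (by positivity)
    obtain ⟨z, hz, hs⟩ := ih (s - max m (s - n * #B)) (by
      rcases max_cases m (s - n * #B) with h | h <;> linarith) (by
      linarith [le_max_right m (s - n * #B)])
    -- The new vertex gets `m`, or more if the others cannot absorb the rest at `n` each.
    refine ⟨Function.update z b (max m (s - n * #B)), fun v => ?_, ?_⟩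
    · by_cases hv : v = b
      · subst hv
        rw [Function.update_self]
        exact ⟨le_max_left _ _, max_le hmn (by linarith)⟩
      · rw [Function.update_of_ne hv]
        exact hz v
    · rw [sum_insert hb, Function.update_self, sum_congr rfl fun v hv =>
        Function.update_of_ne (ne_of_mem_of_not_mem hv hb) _ z, hs]
      ring

/-- A positive integer edge weighting with total `m` on `A` and totals in `[m, n]` on `B`. -/
structure IsPosWeighting {V : Type*} [Fintype V] (G : SimpleGraph V) (A B : Set V) (n m : ℕ)
    (w : V → V → ℤ) : Prop where
  symm : ∀ u v, w u v = w v u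
  supp : ∀ u v, ¬ G.Adj u v → w u v = 0
  pos : ∀ u v, G.Adj u v → 0 < w u v
  sum_left : ∀ a ∈ A, ∑ u, w a u = m
  le_sum_right : ∀ b ∈ B, (m : ℤ) ≤ ∑ u, w b u
  sum_right_le : ∀ b ∈ B, ∑ u, w b u ≤ n

/-- The last two hypotheses say that the remaining demand `m|A| - c` can be spread over `B \ {x}`
with values in `[m, n]`. -/
theorem MemT.exists_posWeighting {V : Type*} [Fintype V] {T : SimpleGraph V} {n m : ℕ} (hm : 0 < m)
    (hmn : m ≤ n) (hT : MemT n m T) {A B : Set V} (hAB : IsBipartition T A B) {x : V} (hx : x ∈ B)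
    {c : ℤ} (hc : m ≤ c) (hc' : c ≤ n) (h1 : (m : ℤ) * (B.ncard - 1) ≤ m * A.ncard - c)
    (h2 : (m : ℤ) * A.ncard - c ≤ n * (B.ncard - 1)) :
    ∃ w, IsPosWeighting T A B n m w ∧ ∑ u, w x u = c := by
  classical
  have hmn' : (m : ℤ) ≤ n := by exact_mod_cast hmn
  have hdisj : ∀ v, v ∈ B → v ∉ A := fun v hB hA => hAB.1.disjoint.le_bot ⟨hA, hB⟩
  have hcov : ∀ v, v ∉ A → v ∈ B := fun v hA =>
    (show v ∈ A ∪ B from hAB.2 ▸ Set.mem_univ v).resolve_left hA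
  have hcardB : ((#(B.toFinset.erase x) : ℕ) : ℤ) = B.ncard - 1 := by
    rw [card_erase_of_mem (by simpa using hx), Set.ncard_eq_toFinset_card',
      Nat.cast_sub (card_pos.2 ⟨x, by simpa using hx⟩)]
    simp
  rw [← hcardB] at h1 h2
  obtain ⟨z₀, hz₀, hsum⟩ := exists_sum_eq hmn' _ _ h1 h2
  let z : V → ℤ := fun v => if v ∈ A then m else if v = x then c else z₀ v
  have hz : ∀ v, (m : ℤ) ≤ z v ∧ z v ≤ n := fun v => by
    dsimp only [z]
    split_ifs
    · exact ⟨le_rfl, hmn'⟩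
    · exact ⟨hc, hc'⟩
    · exact hz₀ v
  have hzx : z x = c := by simp [z, hdisj x hx]
  let s : V → ℤ := fun v => if v ∈ A then 1 else -1
  have hs : ∀ u v, T.Adj u v → s u = -s v := fun u v huv => by
    dsimp only [s]
    by_cases hu : u ∈ A
    · simp [hu, hdisj _ (hAB.1.mem_of_mem_adj hu huv)]
    · have : v ∈ A := hAB.1.symm.mem_of_mem_adj (hcov u hu) huv
      simp [hu, this]
  have hs1 : ∀ v, s v * s v = 1 := fun v => by dsimp only [s]; split_ifs <;> simp
  have hB : B.toFinset = univ.filter fun v => v ∉ A := by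
    ext v
    simpa using ⟨hdisj v, hcov v⟩
  have hbal : ∑ v, s v * z v = 0 := by
    rw [← sum_filter_add_sum_filter_not univ (fun v => v ∈ A), ← hB,
      ← sum_erase_add _ _ (show x ∈ B.toFinset by simpa using hx), hzx]
    have e1 : ∑ v ∈ univ.filter (fun v => v ∈ A), s v * z v = m * A.ncard := by
      rw [sum_congr rfl (g := fun _ => (m : ℤ)) fun v hv => by
        simp [s, z, (mem_filter.1 hv).2], Set.ncard_eq_toFinset_card']
      simp [mul_comm, Set.toFinset]
    have e2 : ∑ v ∈ B.toFinset.erase x, s v * z v = -∑ v ∈ B.toFinset.erase x, z₀ v := by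
      rw [← sum_neg_distrib]
      refine sum_congr rfl fun v hv => ?_
      have hv' := mem_erase.1 hv
      simp [s, z, hdisj v (by simpa using hv'.2), hv'.1]
    rw [e1, e2, hsum, show s x = -1 by simp [s, hdisj x hx]]
    ring
  obtain ⟨w, w1, w2, w3⟩ := exists_int_weighting hT.isTree.connected hs hs1 z hbal
  refine ⟨w, ⟨w1, w2, fun u v huv => ?_, fun a ha => ?_, fun b _ => ?_, fun b _ => ?_⟩, ?_⟩
  · have hW : IsWeighting T (fun u v => (w u v : ℝ)) (fun v => (z v : ℝ)) :=
      ⟨fun u v => by rw [w1], fun u v h => by rw [w2 u v h]; simp, fun v => by rw [← w3 v]; simp⟩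
    exact_mod_cast hT.weighting_pos hm hmn hW (fun v => by exact_mod_cast (hz v).1)
      (fun v => by exact_mod_cast (hz v).2) huv
  · rw [w3]; simp [z, ha]
  · rw [w3]; exact (hz b).1
  · rw [w3]; exact (hz b).2
  · rw [w3, hzx]

theorem MemT.mul_ncard_le {V : Type*} [Finite V] {T : SimpleGraph V} {n m : ℕ} (hm : 0 < m)
    (hT : MemT n m T) {A B : Set V} (hAB : IsBipartition T A B) :
    m * A.ncard ≤ n * B.ncard := by
  have h := hT.iso_le B
  rw [iso_delVerts, div_mul_eq_mul_div, le_div_iff₀ (by exact_mod_cast hm), mul_comm] at h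
  refine le_trans (Nat.mul_le_mul_left _ ?_) (by exact_mod_cast h)
  refine Set.ncard_le_ncard (fun v hv => ⟨fun hB => hAB.1.disjoint.le_bot ⟨hv, hB⟩, fun u hu huv =>
    hu (hAB.1.mem_of_mem_adj hv huv)⟩) (Set.toFinite _)

/-- The total at `x ∈ B` of a positive weighting can be made as small as possible. -/
theorem MemT.exists_posWeighting_min {V : Type*} [Fintype V] {T : SimpleGraph V} {n m : ℕ}
    (hm : 0 < m) (hmn : m ≤ n) (hT : MemT n m T) {A B : Set V} (hAB : IsBipartition T A B)
    (hle : B.ncard ≤ A.ncard) {x : V} (hx : x ∈ B) :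
    ∃ w, IsPosWeighting T A B n m w ∧
      ∑ u, w x u = max (m : ℤ) (m * A.ncard - n * (B.ncard - 1)) := by
  have h1 : (m : ℤ) * A.ncard ≤ n * B.ncard := by exact_mod_cast hT.mul_ncard_le hm hAB
  have h2 : (m : ℤ) * B.ncard ≤ m * A.ncard := by exact_mod_cast Nat.mul_le_mul_left m hle
  have hmn' : (m : ℤ) ≤ n := by exact_mod_cast hmn
  have hB : (0 : ℤ) ≤ B.ncard - 1 := by
    have : 0 < B.ncard := (Set.ncard_pos (Set.toFinite B)).2 ⟨x, hx⟩
    omega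
  have h3 := mul_le_mul_of_nonneg_right hmn' hB
  refine hT.exists_posWeighting hm hmn hAB hx (le_max_left _ _) (max_le hmn' ?_) ?_ ?_
  · linarith
  · rcases max_cases (m : ℤ) (m * A.ncard - n * (B.ncard - 1)) with h | h <;> linarith
  · linarith [le_max_right (m : ℤ) (m * A.ncard - n * (B.ncard - 1))]

/-! ### Degrees, leaves and stars -/

theorem deg_eq_card {V : Type*} [Fintype V] (G : SimpleGraph V) [DecidableRel G.Adj] (v : V) :
    deg G v = #(univ.filter (G.Adj v)) := by
  unfold deg
  rw [← Set.ncard_coe_finset]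
  congr 1
  ext u
  simp

theorem mem_leaf_iff {V : Type*} {G : SimpleGraph V} {v : V} :
    v ∈ leaf G ↔ ∃ u, G.Adj v u ∧ ∀ u', G.Adj v u' → u' = u := by
  simp only [leaf, deg, Set.mem_ofPred_eq, Set.ncard_eq_one, Set.eq_singleton_iff_unique_mem,
    SimpleGraph.mem_neighborSet]

theorem deg_iso {V W : Type*} {G : SimpleGraph V} {H : SimpleGraph W} (e : G ≃g H) (v : V) :
    deg H (e v) = deg G v := by
  unfold deg
  rw [← Set.ncard_image_of_injective _ e.injective]
  congr 1
  ext w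
  constructor
  · intro h
    refine ⟨e.symm w, ?_, by simp⟩
    rw [SimpleGraph.mem_neighborSet] at h ⊢
    rw [← e.map_adj_iff]
    simpa using h
  · rintro ⟨u, hu, rfl⟩
    exact e.map_adj_iff.2 hu

theorem deg_starK_inl (i : ℕ) (j : Fin 1) : deg (starK i) (Sum.inl j) = i := by
  have : (starK i).neighborSet (Sum.inl j) = Set.range Sum.inr := by
    ext v
    rcases v with v | v <;> simp
  rw [deg, this, Set.ncard_range_of_injective Sum.inr_injective, Nat.card_fin]

theorem starK_leaf_nbr {i : ℕ} {j : Fin i} {v : Fin 1 ⊕ Fin i} :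
    (starK i).Adj (Sum.inr j) v ↔ v = Sum.inl 0 := by
  rcases v with v | v
  · simp [Subsingleton.elim v 0]
  · simp

theorem deg_starK_inr (i : ℕ) (j : Fin i) : deg (starK i) (Sum.inr j) = 1 :=
  mem_leaf_iff.2 ⟨Sum.inl 0, by simp, fun _ h => starK_leaf_nbr.1 h⟩

theorem mem_leaf_of_iso_starK_one {V : Type*} {T : SimpleGraph V}
    (h : Nonempty (T ≃g starK 1)) (v : V) : v ∈ leaf T := by
  obtain ⟨e⟩ := h
  show deg T v = 1
  rw [← deg_iso e]
  rcases e v with j | j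
  · exact deg_starK_inl 1 j
  · exact deg_starK_inr 1 j

theorem isTree_starK (i : ℕ) : (starK i).IsTree := by
  have : starK i = SimpleGraph.starGraph (Sum.inl 0) := by
    ext u v
    rcases u with u | u <;> rcases v with v | v <;>
      simp [SimpleGraph.starGraph_adj, Fin.fin_one_eq_zero]
  rw [this]
  exact SimpleGraph.isTree_starGraph _

theorem nonempty_iso_starK {V : Type*} [Finite V] {G : SimpleGraph V} (hG : G.Connected) {b : V}
    (h : ∀ a v, G.Adj b a → G.Adj a v → v = b) : Nonempty (G ≃g starK (deg G b)) := by
  have hall : ∀ v, v ≠ b → G.Adj b v := fun v hv => by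
    obtain ⟨p⟩ := hG.preconnected v b
    induction p with
    | nil => exact absurd rfl hv
    | @cons u u' b huv p ih =>
      by_cases hu' : u' = b
      · subst hu'; exact huv.symm
      · exact absurd (h u' u (ih h hu') huv.symm) hv
  have hadj : ∀ u v, u ≠ b → v ≠ b → ¬ G.Adj u v := fun u v hu hv huv =>
    hv (h u v (hall u hu) huv)
  have hcard : Nat.card {v // ¬ v = b} = deg G b := by
    unfold deg
    rw [← Nat.card_coe_set_eq]
    refine Nat.card_congr (Equiv.subtypeEquivRight fun v => ⟨hall v, fun hv => hv.ne'⟩)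
  let e1 : {v // v = b} ≃ Fin 1 := Equiv.ofUnique _ _
  let e2 : {v // ¬ v = b} ≃ Fin (deg G b) := Finite.equivFinOfCardEq hcard
  classical
  let e : Fin 1 ⊕ Fin (deg G b) ≃ V := (Equiv.sumCongr e1 e2).symm.trans (Equiv.sumCompl (· = b))
  have hl : ∀ i, e (Sum.inl i) = b := fun i => (e1.symm i).2
  have hr : ∀ i, e (Sum.inr i) ≠ b := fun i => (e2.symm i).2
  refine ⟨SimpleGraph.Iso.symm ⟨e, ?_⟩⟩
  intro u v
  rcases u with u | u <;> rcases v with v | v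
  · simp [hl]
  · simpa [hl] using hall _ (hr v)
  · simpa [hl] using (hall _ (hr u)).symm
  · simpa using hadj _ _ (hr u) (hr v)

/-! ### Local consequences of a positive weighting -/

section

variable {V : Type*} [Fintype V] {T : SimpleGraph V} {A B : Set V} {n m : ℕ} {w : V → V → ℤ}

theorem IsPosWeighting.deg_le_sum (hw : IsPosWeighting T A B n m w) (v : V) :
    (deg T v : ℤ) ≤ ∑ u, w v u := by
  classical
  rw [deg_eq_card, card_eq_sum_ones]
  push_cast
  calc ∑ u ∈ univ.filter (T.Adj v), (1 : ℤ) ≤ ∑ u ∈ univ.filter (T.Adj v), w v u :=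
        sum_le_sum fun u hu => hw.pos v u (mem_filter.1 hu).2
    _ = ∑ u, w v u := sum_subset (subset_univ _) fun u _ hu => hw.supp v u (by simpa using hu)

theorem IsPosWeighting.sum_of_unique (hw : IsPosWeighting T A B n m w) {v u : V}
    (h : ∀ u', T.Adj v u' → u' = u) : ∑ x, w v x = w v u :=
  sum_eq_single_of_mem u (mem_univ _) fun x _ hx => hw.supp v x fun hvx => hx (h x hvx)

theorem IsPosWeighting.lt_sum (hw : IsPosWeighting T A B n m w) {v u u' : V}
    (hu' : T.Adj v u') (hne : u' ≠ u) : w v u < ∑ x, w v x := by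
  refine single_lt_sum hne (mem_univ _) (mem_univ _) (hw.pos _ _ hu') fun x _ _ => ?_
  by_cases h : T.Adj v x
  · exact (hw.pos _ _ h).le
  · exact (hw.supp _ _ h).ge

theorem IsPosWeighting.iso_starK_one (hw : IsPosWeighting T A B n m w) (hT : T.Connected)
    (hAB : IsBipartition T A B) {b : V} (hb : b ∈ B) (hleaf : b ∈ leaf T) :
    Nonempty (T ≃g starK 1) := by
  suffices h : Nonempty (T ≃g starK (deg T b)) by
    rwa [show deg T b = 1 from hleaf] at h
  refine nonempty_iso_starK hT fun a v hba hav => ?_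
  by_contra hne
  have ha : a ∈ A := hAB.1.symm.mem_of_mem_adj hb hba
  obtain ⟨u, -, hu⟩ := mem_leaf_iff.1 hleaf
  -- A second neighbor of `a` would leave less than `m` for the edge `ab`, which carries the whole
  -- total of the leaf `b`.
  have h1 := hw.lt_sum hav hne
  have h2 := hw.le_sum_right b hb
  rw [hw.sum_of_unique fun u' h => (hu u' h).trans (hu a hba).symm, hw.symm] at h2
  rw [hw.sum_left a ha] at h1
  exact absurd h1 (not_lt.2 h2)

/-- The total at a vertex `x` all of whose neighbors but one are leaves. -/
theorem IsPosWeighting.sum_mem_Ioo (hw : IsPosWeighting T A B n m w)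
    (hleaf : leaf T ⊆ A) {x a : V} (hxa : T.Adj x a) (haA : a ∈ A) (ha : a ∉ leaf T)
    (hx : ∀ u, T.Adj x u → u ≠ a → u ∈ leaf T) :
    (m : ℤ) * (deg T x - 1) < ∑ u, w x u ∧ ∑ u, w x u < m * deg T x := by
  classical
  have hsum : ∑ u, w x u = w x a + m * (deg T x - 1) := by
    have h1 : ∑ u, w x u = ∑ u ∈ univ.filter (T.Adj x), w x u :=
      (sum_subset (subset_univ _) fun u _ hu => hw.supp x u (by simpa using hu)).symm
    have hmem : a ∈ univ.filter (T.Adj x) := by simpa using hxa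
    rw [h1, ← add_sum_erase _ _ hmem, sum_congr rfl (g := fun _ => (m : ℤ)), sum_const,
      card_erase_of_mem hmem, deg_eq_card, nsmul_eq_mul, Nat.cast_sub (card_pos.2 ⟨a, hmem⟩)]
    · push_cast; ring
    · intro u hu
      obtain ⟨hua, hu⟩ := mem_erase.1 hu
      have hxu : T.Adj x u := (mem_filter.1 hu).2
      have hul := hx u hxu hua
      obtain ⟨v, -, hv⟩ := mem_leaf_iff.1 hul
      rw [hw.symm, ← hw.sum_left u (hleaf hul)]
      exact (hw.sum_of_unique fun u' h => (hv u' h).trans (hv x hxu.symm).symm).symm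
  have hpos := hw.pos _ _ hxa
  -- Not being a leaf, `a` spends part of its `m` on another edge.
  have hlt : w x a < m := by
    obtain ⟨v, hv, hne⟩ : ∃ v, T.Adj a v ∧ v ≠ x := by
      by_contra hcon
      push Not at hcon
      exact ha (mem_leaf_iff.2 ⟨x, hxa.symm, hcon⟩)
    rw [hw.symm, ← hw.sum_left a haA]
    exact hw.lt_sum hv hne
  rw [hsum]
  constructor <;> linarith

end

/-! ### Leaves of the pruned tree -/

theorem exists_of_mem_leaf_delVerts {V : Type*} {T : SimpleGraph V} {A B : Set V}
    (hAB : IsBipartition T A B) (hleaf : leaf T ⊆ A) {x : ↥(leaf T)ᶜ}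
    (hx : x ∈ leaf (delVerts T (leaf T))) :
    x.1 ∈ B ∧ ∃ a, T.Adj x.1 a ∧ a ∈ A ∧ a ∉ leaf T ∧
      ∀ u, T.Adj x.1 u → u ≠ a → u ∈ leaf T := by
  obtain ⟨⟨a, ha⟩, hxa, hu⟩ := mem_leaf_iff.1 hx
  have hxa' : T.Adj x.1 a := hxa
  have hu' : ∀ u, T.Adj x.1 u → u ≠ a → u ∈ leaf T := fun u hxu hua => by
    by_contra hul
    exact hua (congrArg Subtype.val (hu ⟨u, hul⟩ hxu))
  obtain ⟨u, hxu, hua⟩ : ∃ u, T.Adj x.1 u ∧ u ≠ a := by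
    by_contra hcon
    push Not at hcon
    exact x.2 (mem_leaf_iff.2 ⟨a, hxa', hcon⟩)
  have hxB : x.1 ∈ B := hAB.1.mem_of_mem_adj (hleaf (hu' u hxu hua)) hxu.symm
  exact ⟨hxB, a, hxa', hAB.1.symm.mem_of_mem_adj hxB hxa', ha, hu'⟩

theorem exists_mem_leaf_delVerts {V : Type*} [Finite V] {T : SimpleGraph V} (hT : T.IsTree)
    {a b : V} (hab : T.Adj a b) (ha : a ∉ leaf T) (hb : b ∉ leaf T) :
    ∃ x, x ∈ leaf (delVerts T (leaf T)) := by
  classical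
  cases nonempty_fintype V
  have hpre : (delVerts T (leaf T)).Preconnected :=
    hT.connected.preconnected.induce_of_degree_eq_one fun v hv => by
      obtain ⟨u, -, hu⟩ := mem_leaf_iff.1 (not_not.1 hv)
      exact fun c hc d hd => (hu c hc).trans (hu d hd).symm
  have : Nontrivial ↥(leaf T)ᶜ := ⟨⟨a, ha⟩, ⟨b, hb⟩, fun h => hab.ne (congrArg Subtype.val h)⟩
  have htree : (delVerts T (leaf T)).IsTree := ⟨⟨hpre⟩, hT.isAcyclic.induce _⟩
  obtain ⟨x, hx⟩ := htree.exists_vert_degree_one_of_nontrivial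
  exact ⟨x, (deg_eq_degree _ x).trans hx⟩

/-! ### Structure of the minimal trees -/

section

variable {V : Type*} [Finite V] {T : SimpleGraph V} {A B : Set V} {n m : ℕ}

theorem MemT.leaf_subset (hm : 0 < m) (hmn : m < n) (hT : MemT n m T) (hAB : IsBipartition T A B)
    (hle : B.ncard ≤ A.ncard) (h1 : ¬ Nonempty (T ≃g starK 1)) : leaf T ⊆ A := by
  cases nonempty_fintype V
  intro v hv
  by_contra hvA
  have hvB : v ∈ B := (show v ∈ A ∪ B from hAB.2 ▸ Set.mem_univ v).resolve_left hvA
  obtain ⟨w, hw, -⟩ := hT.exists_posWeighting_min hm hmn.le hAB hle hvB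
  exact h1 (hw.iso_starK_one hT.isTree.connected hAB hvB hv)

theorem MemT.deg_le_left (hm : 0 < m) (hmn : m < n) (hT : MemT n m T) (hAB : IsBipartition T A B)
    (hB : 0 < B.ncard) (hle : B.ncard ≤ A.ncard) {a : V} (ha : a ∈ A) : deg T a ≤ m := by
  cases nonempty_fintype V
  obtain ⟨b, hb⟩ := (Set.ncard_pos (Set.toFinite B)).1 hB
  obtain ⟨w, hw, -⟩ := hT.exists_posWeighting_min hm hmn.le hAB hle hb
  exact_mod_cast (hw.deg_le_sum a).trans (hw.sum_left a ha).le

theorem MemT.deg_le_right (hm : 0 < m) (hmn : m < n) (hT : MemT n m T) (hAB : IsBipartition T A B)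
    (hle : B.ncard ≤ A.ncard) {b : V} (hb : b ∈ B) : deg T b ≤ n := by
  cases nonempty_fintype V
  obtain ⟨w, hw, -⟩ := hT.exists_posWeighting_min hm hmn.le hAB hle hb
  exact_mod_cast (hw.deg_le_sum b).trans (hw.sum_right_le b hb)

/-- The total at `x` lies strictly between two consecutive multiples of `m`, so it suffices to
realize the total `n` there. -/
theorem MemT.mul_deg_bounds (hm : 0 < m) (hmn : m < n) (hT : MemT n m T)
    (hAB : IsBipartition T A B) (hle : B.ncard ≤ A.ncard) (hleaf : leaf T ⊆ A) {x : ↥(leaf T)ᶜ}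
    (hx : x ∈ leaf (delVerts T (leaf T))) :
    (m : ℤ) * (deg T x.1 - 1) < n ∧ (n : ℤ) < m * deg T x.1 := by
  cases nonempty_fintype V
  obtain ⟨hxB, a, hxa, haA, ha, hu⟩ := exists_of_mem_leaf_delVerts hAB hleaf hx
  have h1 : (m : ℤ) * A.ncard ≤ n * B.ncard := by exact_mod_cast hT.mul_ncard_le hm hAB
  have h2 : (B.ncard : ℤ) ≤ A.ncard := by exact_mod_cast hle
  have hm' : (0 : ℤ) < m := by exact_mod_cast hm
  have hmn' : (m : ℤ) < n := by exact_mod_cast hmn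
  have hB : (0 : ℤ) ≤ B.ncard - 1 := by
    have : 0 < B.ncard := (Set.ncard_pos (Set.toFinite B)).2 ⟨x, hxB⟩
    omega
  have h3 := mul_le_mul_of_nonneg_right hmn'.le hB
  rcases le_total (n : ℤ) (m * (A.ncard - B.ncard + 1)) with h | h
  · obtain ⟨w, hw, hs⟩ := hT.exists_posWeighting hm hmn.le hAB hxB (c := n) hmn'.le le_rfl
      (by linarith) (by linarith)
    rw [← hs]
    exact hw.sum_mem_Ioo hleaf hxa haA ha hu
  -- If `n` is too large to be realized, let every other vertex of `B` have total `m`: then `x` gets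
  -- a multiple of `m`, which is impossible.
  · obtain ⟨w, hw, hs⟩ := hT.exists_posWeighting hm hmn.le hAB hxB
      (c := m * (A.ncard - B.ncard + 1)) (by nlinarith) h (by linarith) (by linarith)
    obtain ⟨h4, h5⟩ := hw.sum_mem_Ioo hleaf hxa haA ha hu
    rw [hs] at h4 h5
    have h6 := lt_of_mul_lt_mul_left h4 hm'.le
    have h7 := lt_of_mul_lt_mul_left h5 hm'.le
    omega

theorem MemT.deg_eq_floor (hm : 0 < m) (hmn : m < n) (hT : MemT n m T)
    (hAB : IsBipartition T A B) (hle : B.ncard ≤ A.ncard) (hleaf : leaf T ⊆ A) {x : ↥(leaf T)ᶜ}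
    (hx : x ∈ leaf (delVerts T (leaf T))) :
    (deg T x.1 : ℤ) = ⌊(n : ℚ) / (m : ℚ)⌋ + 1 := by
  obtain ⟨h1, h2⟩ := hT.mul_deg_bounds hm hmn hAB hle hleaf hx
  have hm' : (0 : ℚ) < m := by exact_mod_cast hm
  rw [← sub_eq_iff_eq_add, eq_comm, Int.floor_eq_iff, le_div_iff₀ hm', div_lt_iff₀ hm']
  have h1' : (m : ℚ) * (deg T x.1 - 1) < n := by exact_mod_cast h1
  have h2' : (n : ℚ) < m * deg T x.1 := by exact_mod_cast h2
  push_cast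
  constructor <;> linarith

theorem isStar_of_deg_le_one (hT : T.IsTree) (hAB : IsBipartition T A B) {b : V} (hb : b ∈ B)
    (h : ∀ a ∈ A, deg T a ≤ 1) : Nonempty (T ≃g starK (deg T b)) := by
  refine nonempty_iso_starK hT.connected fun a v hba hav => ?_
  exact (Set.ncard_le_one_iff (Set.toFinite _)).1 (h a (hAB.1.symm.mem_of_mem_adj hb hba)) hav hba.symm

theorem MemT.not_isIsolated (hT : MemT n m T) (v : V) : ∃ u, T.Adj v u := by
  by_contra hcon
  push Not at hcon
  have h := hT.iso_le ∅
  rw [iso_delVerts, Set.ncard_empty, Nat.cast_zero, mul_zero] at h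
  have h' := Nat.le_zero.1 (by exact_mod_cast h)
  rw [Set.ncard_eq_zero (Set.toFinite _)] at h'
  exact Set.notMem_empty v (h' ▸ ⟨Set.notMem_empty v, fun u _ => hcon u⟩)

theorem one_le_deg {v u : V} (h : T.Adj v u) : 1 ≤ deg T v :=
  (Set.ncard_pos (Set.toFinite _)).2 ⟨u, h⟩

/-- With strict inequality, `x` could have a total below `n = mq + 1`, that is, at most `mq`; but
its degree exceeds `q`, which forces the total above `mq`. -/
theorem MemT.mul_ncard_eq (hm : 0 < m) (hmn : m < n) (hT : MemT n m T)
    (hAB : IsBipartition T A B) (hB : 0 < B.ncard) (hle : B.ncard ≤ A.ncard)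
    (hmod : n ≡ 1 [MOD m]) (hstar : ¬ IsStar T) : m * A.ncard = n * B.ncard := by
  cases nonempty_fintype V
  refine le_antisymm (hT.mul_ncard_le hm hAB) (not_lt.1 fun hlt => ?_)
  have hleaf := hT.leaf_subset hm hmn hAB hle fun h => hstar ⟨1, le_rfl, h⟩
  obtain ⟨b₀, hb₀⟩ := (Set.ncard_pos (Set.toFinite B)).1 hB
  obtain ⟨a, ha, hda⟩ : ∃ a ∈ A, ¬ deg T a ≤ 1 := by
    by_contra hcon
    push Not at hcon
    have hpos := one_le_deg (hT.not_isIsolated b₀).choose_spec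
    exact hstar ⟨_, hpos, isStar_of_deg_le_one hT.isTree hAB hb₀ hcon⟩
  obtain ⟨b, hab⟩ := hT.not_isIsolated a
  have hbB : b ∈ B := hAB.1.mem_of_mem_adj ha hab
  obtain ⟨x, hx⟩ := exists_mem_leaf_delVerts hT.isTree hab (fun h => hda (le_of_eq h))
    (fun h => hAB.1.disjoint.le_bot ⟨hleaf h, hbB⟩)
  obtain ⟨h1, h2⟩ := hT.mul_deg_bounds hm hmn hAB hle hleaf hx
  obtain ⟨hxB, c, hxc, hcA, hc, hu⟩ := exists_of_mem_leaf_delVerts hAB hleaf hx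
  obtain ⟨w, hw, hs⟩ := hT.exists_posWeighting_min hm hmn.le hAB hle hxB
  have h3 := (hw.sum_mem_Ioo hleaf hxc hcA hc hu).1
  have hmn' : (m : ℤ) < n := by exact_mod_cast hmn
  have hlt' : (m : ℤ) * A.ncard < n * B.ncard := by exact_mod_cast hlt
  have h4 : ∑ u, w x.1 u < n := by
    rw [hs]
    exact max_lt hmn' (by linarith)
  obtain ⟨q, hq⟩ := (Nat.modEq_iff_dvd' (by omega)).1 hmod.symm
  have hq' : (n : ℤ) = m * q + 1 := by
    have : n = m * q + 1 := by omega
    exact_mod_cast this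
  have hm' : (0 : ℤ) < m := by exact_mod_cast hm
  have h5 : (m : ℤ) * (q : ℤ) < m * deg T x.1 := by linarith
  have h6 := lt_of_mul_lt_mul_left h5 hm'.le
  have h7 : (m : ℤ) * q ≤ m * (deg T x.1 - 1) := mul_le_mul_of_nonneg_left (by omega) hm'.le
  linarith

theorem ncard_eq_and_dvd_of_mul_eq (hm : 0 < m) (hAB : IsBipartition T A B)
    (hmod : n ≡ 1 [MOD m]) (h : m * A.ncard = n * B.ncard) :
    (A.ncard : ℚ) = (n : ℚ) / (m : ℚ) * (B.ncard : ℚ) ∧ (n + m) ∣ Nat.card V := by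
  constructor
  · rw [div_mul_eq_mul_div, eq_div_iff (by exact_mod_cast hm.ne'), mul_comm]
    exact_mod_cast h
  · have hcop : Nat.Coprime m n := by
      rw [Nat.coprime_comm, Nat.Coprime, hmod.gcd_eq, Nat.gcd_one_left]
    obtain ⟨t, ht⟩ : m ∣ B.ncard := hcop.dvd_of_dvd_mul_left ⟨_, h.symm⟩
    have hA : A.ncard = n * t := by
      rw [ht, mul_left_comm] at h
      exact Nat.eq_of_mul_eq_mul_left hm h
    refine ⟨t, ?_⟩
    rw [← Set.ncard_univ, ← hAB.2, Set.ncard_union_eq hAB.1.disjoint, hA, ht, add_mul]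

theorem MemT.exists_isBipartition (hT : MemT n m T) :
    ∃ A B : Set V, IsBipartition T A B ∧ 0 < B.ncard ∧ B.ncard ≤ A.ncard := by
  obtain ⟨s, t, hst⟩ := SimpleGraph.isBipartite_iff_exists_isBipartiteWith.1 hT.isTree.isBipartite
  have hcov : s ∪ t = Set.univ := Set.eq_univ_of_forall fun v =>
    SimpleGraph.isBipartiteWith_support_subset hst (hT.not_isIsolated v)
  obtain ⟨v⟩ := hT.isTree.connected.nonempty
  obtain ⟨u, hvu⟩ := hT.not_isIsolated v
  have hne : s.Nonempty ∧ t.Nonempty := by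
    rcases hst.mem_of_adj hvu with ⟨h1, h2⟩ | ⟨h1, h2⟩
    exacts [⟨⟨_, h1⟩, ⟨_, h2⟩⟩, ⟨⟨_, h2⟩, ⟨_, h1⟩⟩]
  rcases le_total t.ncard s.ncard with h | h
  · exact ⟨s, t, ⟨hst, hcov⟩, (Set.ncard_pos (Set.toFinite _)).2 hne.2, h⟩
  · exact ⟨t, s, ⟨hst.symm, by rw [Set.union_comm, hcov]⟩,
      (Set.ncard_pos (Set.toFinite _)).2 hne.1, h⟩

theorem MemT.exists_iso_starK (hn : 1 < n) (hT : MemT n 1 T) :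
    ∃ i : ℕ, 1 ≤ i ∧ i ≤ n ∧ Nonempty (T ≃g starK i) := by
  obtain ⟨A, B, hAB, hB, hle⟩ := hT.exists_isBipartition
  obtain ⟨b, hb⟩ := (Set.ncard_pos (Set.toFinite B)).1 hB
  have hpos := one_le_deg (hT.not_isIsolated b).choose_spec
  exact ⟨deg T b, hpos, hT.deg_le_right one_pos hn hAB hle hb,
    isStar_of_deg_le_one hT.isTree hAB hb fun a ha =>
      hT.deg_le_left one_pos hn hAB hB hle ha⟩

/-- Unit weights have the degrees as totals, all in `[1, n]`; deleting an edge isolates its leaf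
end, so `S = ∅` witnesses minimality. -/
theorem memT_of_iso_starK (hn : 1 < n) {i : ℕ} (hi : 1 ≤ i) (hin : i ≤ n) (e : T ≃g starK i) :
    MemT n 1 T := by
  classical
  cases nonempty_fintype V
  have hdeg : ∀ v, 1 ≤ deg T v ∧ deg T v ≤ n := fun v => by
    rw [← deg_iso e]
    rcases e v with j | j
    · rw [deg_starK_inl]; exact ⟨hi, hin⟩
    · rw [deg_starK_inr]; exact ⟨le_rfl, hn.le⟩
  refine ⟨e.isTree_iff.2 (isTree_starK i), fun S => ?_, fun f => ?_⟩
  · have hW : IsWeighting T (fun u v => if T.Adj u v then 1 else 0) (fun v => (deg T v : ℝ)) :=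
      ⟨fun u v => by simp [T.adj_comm], fun u v h => if_neg h, fun v => by
        rw [deg_eq_card]; simp⟩
    exact hW.iso_le (fun u v => by split_ifs <;> simp) one_pos
      (fun v => by exact_mod_cast (hdeg v).1) (fun v => by exact_mod_cast (hdeg v).2) S
  · induction f using Sym2.ind with
    | _ u v =>
      intro huv
      have key : ∀ x y, s(x, y) = s(u, v) → (∀ z, T.Adj x z → z = y) →
          0 < iso (delVerts (T.deleteEdges {s(u, v)}) ∅) := fun x y hxy hx => by
        rw [iso_delVerts, Set.ncard_pos (Set.toFinite _)]
        refine ⟨x, Set.notMem_empty x, fun z _ hz => ?_⟩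
        rw [SimpleGraph.deleteEdges_adj] at hz
        exact hz.2 (by rw [hx z hz.1, hxy]; rfl)
      have hnbr : ∀ x y j, T.Adj x y → e x = Sum.inr j → ∀ z, T.Adj x z → z = y :=
        fun x y j hxy hj z hz => by
          have h1 := e.map_adj_iff.2 hxy
          have h2 := e.map_adj_iff.2 hz
          rw [hj, starK_leaf_nbr] at h1 h2
          exact e.injective (h2.trans h1.symm)
      refine ⟨∅, ?_⟩
      rw [Set.ncard_empty, Nat.cast_zero, mul_zero, Nat.cast_pos]
      have huv' : T.Adj u v := huv
      rcases hu : e u with j | j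
      · rcases hv : e v with k | k
        · have := e.map_adj_iff.2 huv'
          rw [hu, hv] at this
          simp at this
        · exact key v u Sym2.eq_swap (hnbr v u k huv'.symm hv)
      · exact key u v rfl (hnbr u v j huv' hu)

end

end IsoFactor

theorem mainTheorem5 {V : Type*} [Finite V] (T : SimpleGraph V) :
    (∀ n m : ℕ, 0 < m → m < n → IsoFactor.MemT n m T →
      ∀ A B : Set V, IsoFactor.IsBipartition T A B → 0 < B.ncard → B.ncard ≤ A.ncard →
        Xor (Nonempty (T ≃g IsoFactor.starK 1)) (IsoFactor.leaf T ⊆ A) ∧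
        (∀ a ∈ A, IsoFactor.deg T a ≤ m) ∧
        (∀ b ∈ B, IsoFactor.deg T b ≤ n) ∧
        (∀ x ∈ IsoFactor.leaf (IsoFactor.delVerts T (IsoFactor.leaf T)),
          (IsoFactor.deg T x.1 : ℤ) = ⌊(n : ℚ) / (m : ℚ)⌋ + 1) ∧
        (n ≡ 1 [MOD m] →
          IsoFactor.IsStar T ∨
            ((A.ncard : ℚ) = (n : ℚ) / (m : ℚ) * (B.ncard : ℚ) ∧ (n + m) ∣ Nat.card V))) ∧
    (∀ n : ℕ, 1 < n →
      (IsoFactor.MemT n 1 T ↔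
        ∃ i : ℕ, 1 ≤ i ∧ i ≤ n ∧ Nonempty (T ≃g IsoFactor.starK i))) := by
  refine ⟨fun n m hm hmn hT A B hAB hB hle => ⟨?_, fun a ha => hT.deg_le_left hm hmn hAB hB hle ha,
    fun b hb => hT.deg_le_right hm hmn hAB hle hb, fun x hx => ?_, fun hmod => ?_⟩,
    fun n hn => ⟨fun hT => hT.exists_iso_starK hn, ?_⟩⟩
  · by_cases h : Nonempty (T ≃g IsoFactor.starK 1)
    · obtain ⟨b, hb⟩ := (Set.ncard_pos (Set.toFinite B)).1 hB
      exact Or.inl ⟨h, fun hA => hAB.1.disjoint.le_bot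
        ⟨hA (IsoFactor.mem_leaf_of_iso_starK_one h b), hb⟩⟩
    · exact Or.inr ⟨hT.leaf_subset hm hmn hAB hle h, h⟩
  · refine hT.deg_eq_floor hm hmn hAB hle (hT.leaf_subset hm hmn hAB hle fun h => ?_) hx
    -- In `K_{1,1}` every vertex is a leaf, so pruning leaves no `x`.
    exact x.2 (IsoFactor.mem_leaf_of_iso_starK_one h x.1)
  · by_cases hstar : IsoFactor.IsStar T
    · exact Or.inl hstar
    · exact Or.inr (IsoFactor.ncard_eq_and_dvd_of_mul_eq hm hAB hmod
        (hT.mul_ncard_eq hm hmn hAB hB hle hmod hstar))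
  · rintro ⟨i, hi, hin, ⟨e⟩⟩
    exact IsoFactor.memT_of_iso_starK hn hi hin e
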